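/- Let $G$ be a finite simple connected cubic (3-regular) graph on $n\ge 6$ vertices that contains a triangle-factor, i.e. whose vertex set can be partitioned into 3-element sets each inducing a triangle. In the Maker--Breaker total domination game on $G$, two players, Dominator and Staller, alternately claim one unclaimed vertex of $G$ each, until all vertices are claimed; Staller wins if she has claimed all vertices of the open neighbourhood $N_G(v)$ of some vertex $v$, and Dominator wins otherwise. If $n=6$, then $G$ is a Dominator win: Dominator has a winning strategy, no matter which of the players moves first. If $n>6$, then $G$ is a Staller win: Staller has a winning strategy, no matter which of the players moves first (so even if she moves second). -/

import Mathlib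

/-! ### Maker--Breaker games on a finite board -/

namespace MakerBreaker

/-- A (deterministic, perfect information) strategy on the board `X`: to every history of the game,
i.e. the list of all elements claimed so far by the two players with the most recent one first,
it assigns the element to be claimed next; this has to be a free element as long as there is one.
(The player who claimed an element of the history is determined by its place in it.) -/
structure Strategy (X : Type*) where
  move : List X → X
  legal : ∀ h : List X, (∃ x, x ∉ h) → move h ∉ h

variable {X : Type*}

/-- The element claimed after the history `h` when the first player uses `σ` and the second `τ`:
the first player moves after histories of even length, the second after those of odd length. -/
def next (σ τ : Strategy X) (h : List X) : X :=
  if Even h.length then σ.move h else τ.move h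

/-- The history after `k` moves (most recent move first) when the first player uses `σ` and the
second player uses `τ`. -/
def play (σ τ : Strategy X) : ℕ → List X
  | 0 => []
  | k + 1 => next σ τ (play σ τ k) :: play σ τ k

/-- The elements claimed by the first player until the board is exhausted, which happens after
exactly `Fintype.card X` moves. -/
def firstClaims [Fintype X] (σ τ : Strategy X) : Set X :=
  {x | ∃ k < Fintype.card X, Even k ∧ next σ τ (play σ τ k) = x}

/-- The elements claimed by the second player until the board is exhausted. -/
def secondClaims [Fintype X] (σ τ : Strategy X) : Set X :=
  {x | ∃ k < Fintype.card X, Odd k ∧ next σ τ (play σ τ k) = x}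

/-- In the game `(X, F)`, Maker has a winning strategy as the first player. -/
def MakerWinsFirst [Fintype X] (F : Set (Set X)) : Prop :=
  ∃ σ : Strategy X, ∀ τ : Strategy X, ∃ A ∈ F, A ⊆ firstClaims σ τ

/-- In the game `(X, F)`, Maker has a winning strategy as the second player. -/
def MakerWinsSecond [Fintype X] (F : Set (Set X)) : Prop :=
  ∃ τ : Strategy X, ∀ σ : Strategy X, ∃ A ∈ F, A ⊆ secondClaims σ τ

/-- In the game `(X, F)`, Breaker has a winning strategy as the first player:
Maker, who moves second, never claims a whole winning set. -/
def BreakerWinsFirst [Fintype X] (F : Set (Set X)) : Prop :=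
  ∃ σ : Strategy X, ∀ τ : Strategy X, ¬ ∃ A ∈ F, A ⊆ secondClaims σ τ

/-- In the game `(X, F)`, Breaker has a winning strategy as the second player. -/
def BreakerWinsSecond [Fintype X] (F : Set (Set X)) : Prop :=
  ∃ τ : Strategy X, ∀ σ : Strategy X, ¬ ∃ A ∈ F, A ⊆ firstClaims σ τ

end MakerBreaker

/-! ### The Maker--Breaker total domination game -/

namespace SimpleGraph

variable {V : Type*}

/-- The winning sets of Staller (who is Maker): the open neighbourhoods of the vertices. -/
def openNeighborhoods (G : SimpleGraph V) : Set (Set V) :=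
  Set.range G.neighborSet

/-- `G` is a Dominator win: Dominator (who is Breaker) wins the Maker--Breaker total domination game
on `G` both as the first and as the second player. -/
def IsDominatorWin [Fintype V] (G : SimpleGraph V) : Prop :=
  MakerBreaker.BreakerWinsFirst G.openNeighborhoods ∧
    MakerBreaker.BreakerWinsSecond G.openNeighborhoods

/-- `G` is a Staller win: Staller (who is Maker) wins the Maker--Breaker total domination game
on `G` both as the first and as the second player. -/
def IsStallerWin [Fintype V] (G : SimpleGraph V) : Prop :=
  MakerBreaker.MakerWinsFirst G.openNeighborhoods ∧
    MakerBreaker.MakerWinsSecond G.openNeighborhoods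

/-- `G` contains a triangle-factor: its vertex set can be partitioned into (the vertex sets of)
triangles. -/
def HasTriangleFactor [Fintype V] [DecidableEq V] (G : SimpleGraph V) : Prop :=
  ∃ P : Finpartition (Finset.univ : Finset V), ∀ t ∈ P.parts, G.IsNClique 3 t

end SimpleGraph

/-! Contract every triangle. Each vertex `v` has exactly one neighbour `m v` outside its triangle,
so the triangles become the vertices of a connected cubic multigraph without loops whose edges are
the pairs `{v, m v}`. Below, the colour `c v` is the triangle of `v`.

If `n = 6`, the graph is the prism. Dominator pairs the vertices so that every neighbourhood
contains a pair (`exists_pairing_of_card_eq_two`) and always answers inside the pair.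

If `n > 6`, there are at least four triangles, by parity. An extra move never hurts Staller, so it
suffices that she wins after Dominator has opened with an arbitrary `x`
(`makerWinsFrom_of_four_le`). Without the triangle of `x` the multigraph still has at least as many
edges as vertices, hence contains a cycle. In a shortest such cycle, minimality and connectivity
keep the third edge at each triangle from returning to the cycle, and rotating by one triangle if
necessary keeps that edge at the first triangle from ending in `x`
(`exists_isCircuit_with_free_pendant`). The neighbourhoods along the cycle, with one more for the
free edge, form an `IsNecklace`. There Staller wins by forcing moves around the cycle that end in a
double threat (`IsNecklace.makerWinsFrom`). -/

namespace MakerBreaker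

/-! ### Histories, the claims of each player, and strategies given by rules. -/

section Histories

variable {X : Type*}

/-- The elements of the history `h` that were claimed after histories whose length has
parity `e`. -/
def claims (e : ℕ) : List X → Set X
  | [] => ∅
  | x :: h => {y | y ∈ claims e h ∨ (h.length % 2 = e ∧ y = x)}

theorem claims_cons_of_eq {e : ℕ} {h : List X} (x : X) (he : h.length % 2 = e) :
    claims e (x :: h) = insert x (claims e h) := by
  ext y
  simp [claims, he, or_comm]

theorem claims_cons_of_ne {e : ℕ} {h : List X} (x : X) (he : h.length % 2 ≠ e) :
    claims e (x :: h) = claims e h := by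
  ext y
  simp [claims, he]

theorem mem_of_mem_claims {e : ℕ} {h : List X} {x : X} (hx : x ∈ claims e h) : x ∈ h := by
  induction h with
  | nil => exact hx.elim
  | cons y h ih =>
    rcases hx with hx | ⟨-, rfl⟩
    · exact List.mem_cons_of_mem _ (ih hx)
    · exact List.mem_cons_self

theorem mem_iff_mem_claims {e e' : ℕ} (hee : e + e' = 1) {h : List X} {x : X} :
    x ∈ h ↔ x ∈ claims e h ∨ x ∈ claims e' h := by
  refine ⟨fun hx => ?_, fun hx => hx.elim mem_of_mem_claims mem_of_mem_claims⟩
  induction h with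
  | nil => simp at hx
  | cons y h ih =>
    rcases List.mem_cons.1 hx with rfl | hx
    · have : h.length % 2 = e ∨ h.length % 2 = e' := by omega
      exact this.imp (fun h => Or.inr ⟨h, rfl⟩) (fun h => Or.inr ⟨h, rfl⟩)
    · exact (ih hx).imp Or.inl Or.inl

theorem not_mem_claims_of_nodup {e e' : ℕ} (hee : e + e' = 1) {h : List X} (hn : h.Nodup) {x : X}
    (hx : x ∈ claims e h) : x ∉ claims e' h := by
  induction h with
  | nil => exact hx.elim
  | cons y h ih =>
    obtain ⟨hy, hn⟩ := List.nodup_cons.1 hn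
    rintro (hx' | ⟨h1, rfl⟩)
    · rcases hx with hx | ⟨h2, rfl⟩
      · exact ih hn hx hx'
      · exact hy (mem_of_mem_claims hx')
    · rcases hx with hx | ⟨h2, -⟩
      · exact hy (mem_of_mem_claims hx)
      · omega

theorem exists_notMem_of_length_lt [Fintype X] {h : List X} (hl : h.length < Fintype.card X) :
    ∃ x, x ∉ h := by
  classical
  by_contra! hc
  have h1 : (Finset.univ : Finset X) ⊆ h.toFinset := fun x _ => List.mem_toFinset.2 (hc x)
  have h2 := Finset.card_le_card h1
  have h3 := h.toFinset_card_le
  rw [Finset.card_univ] at h2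
  omega

open Classical in
/-- The strategy that claims a free element allowed by the rule `good` whenever there is one. -/
noncomputable def Strategy.ofRule [Nonempty X] (good : List X → X → Prop) : Strategy X where
  move h := if h1 : ∃ x, x ∉ h ∧ good h x then h1.choose else
    if h2 : ∃ x, x ∉ h then h2.choose else Classical.arbitrary X
  legal h hx := by
    by_cases h1 : ∃ x, x ∉ h ∧ good h x
    · rw [dif_pos h1]
      exact h1.choose_spec.1
    · rw [dif_neg h1, dif_pos hx]
      exact hx.choose_spec

theorem Strategy.ofRule_good [Nonempty X] {good : List X → X → Prop} {h : List X} {x : X}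
    (hx : x ∉ h) (hg : good h x) : good h ((Strategy.ofRule good).move h) := by
  have h1 : ∃ x, x ∉ h ∧ good h x := ⟨x, hx, hg⟩
  simp only [Strategy.ofRule, dif_pos h1]
  exact h1.choose_spec.2

@[simp]
theorem length_play (σ τ : Strategy X) (k : ℕ) : (play σ τ k).length = k := by
  induction k with
  | zero => rfl
  | succ k ih => simp [play, ih]

theorem next_notMem (σ τ : Strategy X) {h : List X} (hx : ∃ x, x ∉ h) : next σ τ h ∉ h := by
  unfold next
  split_ifs
  · exact σ.legal h hx
  · exact τ.legal h hx

theorem next_play_notMem [Fintype X] (σ τ : Strategy X) {k : ℕ} (hk : k < Fintype.card X) :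
    next σ τ (play σ τ k) ∉ play σ τ k :=
  next_notMem σ τ (exists_notMem_of_length_lt (by simpa using hk))

theorem nodup_play [Fintype X] (σ τ : Strategy X) {k : ℕ} (hk : k ≤ Fintype.card X) :
    (play σ τ k).Nodup := by
  induction k with
  | zero => exact List.nodup_nil
  | succ k ih => exact List.nodup_cons.2 ⟨next_play_notMem σ τ hk, ih (by omega)⟩

theorem mem_play_card [Fintype X] (σ τ : Strategy X) (x : X) :
    x ∈ play σ τ (Fintype.card X) := by
  classical
  have h1 : (play σ τ (Fintype.card X)).toFinset = Finset.univ := by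
    rw [← Finset.card_eq_iff_eq_univ, List.toFinset_card_of_nodup (nodup_play σ τ le_rfl),
      length_play]
  exact List.mem_toFinset.1 (h1 ▸ Finset.mem_univ x)

theorem mem_claims_play {e : ℕ} (σ τ : Strategy X) (n : ℕ) (x : X) :
    x ∈ claims e (play σ τ n) ↔ ∃ k < n, k % 2 = e ∧ next σ τ (play σ τ k) = x := by
  induction n with
  | zero => simp [play, claims]
  | succ n ih =>
    simp only [play, claims, Set.mem_ofPred_eq, ih, length_play]
    constructor
    · rintro (⟨k, hk, h⟩ | ⟨h, rfl⟩)
      · exact ⟨k, by omega, h⟩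
      · exact ⟨n, by omega, h, rfl⟩
    · rintro ⟨k, hk, h, rfl⟩
      rcases Nat.lt_succ_iff_lt_or_eq.1 hk with hk | rfl
      · exact Or.inl ⟨k, hk, h, rfl⟩
      · exact Or.inr ⟨h, rfl⟩

theorem firstClaims_eq [Fintype X] (σ τ : Strategy X) :
    firstClaims σ τ = claims 0 (play σ τ (Fintype.card X)) := by
  ext x
  simp only [firstClaims, mem_claims_play, Set.mem_ofPred_eq, Nat.even_iff]

theorem secondClaims_eq [Fintype X] (σ τ : Strategy X) :
    secondClaims σ τ = claims 1 (play σ τ (Fintype.card X)) := by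
  ext x
  simp only [secondClaims, mem_claims_play, Set.mem_ofPred_eq, Nat.odd_iff]

end Histories

/-! ### Positions won by Maker, and forcing sequences. -/

section Maker

variable {X : Type*} {F : Set (Set X)}

/-- `MakerWinsFrom F M B`: Maker, who has claimed `M` and is to move, can claim a whole member of
`F` against a Breaker who has claimed `B`. -/
inductive MakerWinsFrom (F : Set (Set X)) : Set X → Set X → Prop
  | full {M B A : Set X} : A ∈ F → A ⊆ M → MakerWinsFrom F M B
  | last {M B A : Set X} {x : X} : A ∈ F → x ∉ M → x ∉ B → A ⊆ insert x M → MakerWinsFrom F M B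
  | move {M B : Set X} {x : X} : x ∉ M → x ∉ B → (∃ y, y ∉ insert x M ∧ y ∉ B) →
      (∀ y, y ∉ insert x M → y ∉ B → MakerWinsFrom F (insert x M) (insert y B)) →
      MakerWinsFrom F M B

/-- `MakerWinsAgainst F M B`: Maker, who has claimed `M`, can claim a whole member of `F` against
a Breaker who has claimed `B` and is to move. -/
def MakerWinsAgainst (F : Set (Set X)) (M B : Set X) : Prop :=
  (∃ A ∈ F, A ⊆ M) ∨
    (∃ y, y ∉ M ∧ y ∉ B) ∧ ∀ y, y ∉ M → y ∉ B → MakerWinsFrom F M (insert y B)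

namespace MakerWinsFrom

theorem full_or_exists_move {M B : Set X} (h : MakerWinsFrom F M B) :
    (∃ A ∈ F, A ⊆ M) ∨ ∃ x, x ∉ M ∧ x ∉ B ∧ MakerWinsAgainst F (insert x M) B := by
  cases h with
  | full hA h => exact Or.inl ⟨_, hA, h⟩
  | last hA h1 h2 h => exact Or.inr ⟨_, h1, h2, Or.inl ⟨_, hA, h⟩⟩
  | move h1 h2 h3 h => exact Or.inr ⟨_, h1, h2, Or.inr ⟨h3, h⟩⟩

/-- Additional Breaker claims never help Maker. This also reduces the game in which Maker opens to
the one in which Breaker does. -/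
theorem anti {M B : Set X} (h : MakerWinsFrom F M B) :
    ∀ {B' : Set X}, B' ⊆ B → MakerWinsFrom F M B' := by
  induction h with
  | full hA h => exact fun _ => full hA h
  | last hA h1 h2 h => exact fun hB => last hA h1 (fun h' => h2 (hB h')) h
  | @move M B x h1 h2 h3 h ih =>
    intro B' hB
    obtain ⟨z, hz1, hz2⟩ := h3
    refine move h1 (fun h' => h2 (hB h')) ⟨z, hz1, fun h' => hz2 (hB h')⟩ fun y hy1 hy2 => ?_
    -- A reply already contained in `B` is wasted; Maker pretends that Breaker played the free
    -- element `z` instead.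
    by_cases hy : y ∈ B
    · exact ih z hz1 hz2 ((Set.insert_subset hy hB).trans (Set.subset_insert _ _))
    · exact ih y hy1 hy (Set.insert_subset_insert hB)

/-- After `x`, only `y` is missing from `A`, so any reply other than `y` loses at once. -/
theorem force {M B A : Set X} {x y : X} (hA : A ∈ F) (hAs : A ⊆ insert y (insert x M))
    (hxM : x ∉ M) (hxB : x ∉ B) (hyM : y ∉ M) (hyB : y ∉ B) (hyx : y ≠ x)
    (h : MakerWinsFrom F (insert x M) (insert y B)) : MakerWinsFrom F M B := by
  have hy : y ∉ insert x M := by simp [hyx, hyM]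
  refine move hxM hxB ⟨y, hy, hyB⟩ fun z hz1 hz2 => ?_
  by_cases hzy : z = y
  · exact hzy ▸ h
  · exact last hA hy (by simp [hyB, Ne.symm hzy]) hAs

theorem double {M B A A' : Set X} {x y y' : X} (hA : A ∈ F) (hAs : A ⊆ insert y (insert x M))
    (hA' : A' ∈ F) (hAs' : A' ⊆ insert y' (insert x M))
    (hxM : x ∉ M) (hxB : x ∉ B) (hyM : y ∉ M) (hyB : y ∉ B) (hyx : y ≠ x)
    (hyM' : y' ∉ M) (hyB' : y' ∉ B) (hyx' : y' ≠ x) (hyy : y' ≠ y) : MakerWinsFrom F M B :=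
  force hA hAs hxM hxB hyM hyB hyx <|
    last hA' (x := y') (by simp [hyx', hyM']) (by simp [hyy, hyB']) hAs'

/-- Maker runs through `a 1, …, a m`, and Breaker is forced to answer with `b 0, …, b (m - 1)`. -/
theorem chain {M B : Set X} {a b : ℕ → X} {m : ℕ} (ha0 : a 0 ∈ M)
    (hF : ∀ i < m, {a i, b i, a (i + 1)} ∈ F)
    (ha : ∀ i < m, a (i + 1) ∉ M ∧ a (i + 1) ∉ B) (hb : ∀ i < m, b i ∉ M ∧ b i ∉ B)
    (haa : ∀ i < m, ∀ j < m, a (i + 1) = a (j + 1) → i = j)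
    (hbb : ∀ i < m, ∀ j < m, b i = b j → i = j)
    (hab : ∀ i < m, ∀ j < m, a (i + 1) ≠ b j)
    (h : MakerWinsFrom F (M ∪ {x | ∃ i < m, x = a (i + 1)}) (B ∪ {x | ∃ i < m, x = b i})) :
    MakerWinsFrom F M B := by
  induction m with
  | zero => simpa using h
  | succ m ih =>
    refine ih (fun i hi => hF i (by omega)) (fun i hi => ha i (by omega))
      (fun i hi => hb i (by omega)) (fun i hi j hj => haa i (by omega) j (by omega))
      (fun i hi j hj => hbb i (by omega) j (by omega))
      (fun i hi j hj => hab i (by omega) j (by omega)) ?_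
    have hs : ∀ (S : Set X) (c : ℕ → X), S ∪ {x | ∃ i < m + 1, x = c i} =
        insert (c m) (S ∪ {x | ∃ i < m, x = c i}) := by
      intro S c
      ext x
      simp only [Set.mem_union, Set.mem_ofPred_eq, Set.mem_insert_iff, Nat.lt_succ_iff_lt_or_eq,
        or_and_right, exists_or, exists_eq_left]
      exact or_assoc.symm.trans or_comm
    rw [hs M fun i => a (i + 1), hs B b] at h
    refine force (hF m (by omega)) ?_ ?_ ?_ ?_ ?_ (hab m (by omega) m (by omega)).symm h
    · rintro x (rfl | rfl | rfl)
      · refine Or.inr (Or.inr ?_)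
        rcases m with _ | m
        · exact Or.inl ha0
        · exact Or.inr ⟨m, by omega, rfl⟩
      · exact Or.inl rfl
      · exact Or.inr (Or.inl rfl)
    · rintro (h' | ⟨i, hi, h'⟩)
      · exact (ha m (by omega)).1 h'
      · have := haa _ (by omega) _ (by omega) h'
        omega
    · rintro (h' | ⟨i, hi, h'⟩)
      · exact (ha m (by omega)).2 h'
      · exact hab _ (by omega) _ (by omega) h'
    · rintro (h' | ⟨i, hi, h'⟩)
      · exact (hb m (by omega)).1 h'
      · exact hab _ (by omega) _ (by omega) h'.symm
    · rintro (h' | ⟨i, hi, h'⟩)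
      · exact (hb m (by omega)).2 h'
      · have := hbb _ (by omega) _ (by omega) h'
        omega

end MakerWinsFrom

/-- Maker, moving after the histories whose length has parity `e`, keeps a won position. -/
noncomputable def makerStrategy [Nonempty X] (F : Set (Set X)) (e e' : ℕ) : Strategy X :=
  Strategy.ofRule fun h x => MakerWinsAgainst F (insert x (claims e h)) (claims e' h)

theorem exists_subset_claims [Fintype X] [Nonempty X] {e e' : ℕ} (hee : e + e' = 1)
    {σ τ : Strategy X}
    (hnext : ∀ h : List X, h.length % 2 = e → next σ τ h = (makerStrategy F e e').move h)
    (h0 : MakerWinsFrom F ∅ ∅) (h1 : ∀ x, MakerWinsFrom F ∅ {x}) :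
    ∃ A ∈ F, A ⊆ claims e (play σ τ (Fintype.card X)) := by
  -- Invariant: Maker already owns a winning set, or the position is won for her with the
  -- appropriate player to move. On a full board only the first case can hold, because the others
  -- supply a free element.
  have key : ∀ k ≤ Fintype.card X,
      (∃ A ∈ F, A ⊆ claims e (play σ τ k)) ∨
      (k % 2 = e ∧ MakerWinsFrom F (claims e (play σ τ k)) (claims e' (play σ τ k))) ∨
      (k % 2 = e' ∧ MakerWinsAgainst F (claims e (play σ τ k)) (claims e' (play σ τ k))) := by
    intro k hk
    induction k with
    | zero =>
      rcases Nat.eq_zero_or_pos e with rfl | he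
      · exact Or.inr (Or.inl ⟨rfl, h0⟩)
      · refine Or.inr (Or.inr ⟨by omega, Or.inr ⟨?_, fun y _ _ => ?_⟩⟩)
        · exact ⟨Classical.arbitrary X, id, id⟩
        · exact (h1 y).anti (by simp [play, claims])
    | succ k ih =>
      have hlen := length_play σ τ k
      have hnm := next_play_notMem σ τ (k := k) (by omega)
      have hmem := fun x => mem_iff_mem_claims hee (h := play σ τ k) (x := x)
      rcases ih (by omega) with ⟨A, hA, hs⟩ | ⟨hpar, hw⟩ | ⟨hpar, hw⟩
      · exact Or.inl ⟨A, hA, fun x hx => Or.inl (hs hx)⟩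
      · rcases hw.full_or_exists_move with ⟨A, hA, hs⟩ | ⟨x, hx1, hx2, hx⟩
        · exact Or.inl ⟨A, hA, fun x hx => Or.inl (hs hx)⟩
        · refine Or.inr (Or.inr ⟨by omega, ?_⟩)
          rw [play, claims_cons_of_eq _ (by omega), claims_cons_of_ne _ (by omega),
            hnext _ (by omega)]
          exact Strategy.ofRule_good
            (good := fun h x => MakerWinsAgainst F (insert x (claims e h)) (claims e' h))
            (x := x) (by rw [hmem]; tauto) hx
      · rcases hw with ⟨A, hA, hs⟩ | ⟨-, hw⟩
        · exact Or.inl ⟨A, hA, fun x hx => Or.inl (hs hx)⟩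
        · refine Or.inr (Or.inl ⟨by omega, ?_⟩)
          rw [play, claims_cons_of_ne _ (by omega), claims_cons_of_eq _ (by omega)]
          rw [hmem] at hnm
          exact hw _ (by tauto) (by tauto)
  have hall := fun x => (mem_iff_mem_claims hee).1 (mem_play_card σ τ x)
  rcases key _ le_rfl with h | ⟨-, hw⟩ | ⟨-, h | ⟨⟨y, hy1, hy2⟩, -⟩⟩
  · exact h
  · rcases hw.full_or_exists_move with h | ⟨x, hx1, hx2, -⟩
    · exact h
    · exact ((hall x).elim hx1 hx2).elim
  · exact h
  · exact ((hall y).elim hy1 hy2).elim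

theorem makerWinsFirst_of_makerWinsFrom [Fintype X] [Nonempty X]
    (h1 : ∀ x, MakerWinsFrom F ∅ {x}) : MakerWinsFirst F := by
  refine ⟨makerStrategy F 0 1, fun τ => ?_⟩
  rw [firstClaims_eq]
  refine exists_subset_claims (e' := 1) rfl (fun h hh => ?_)
    ((h1 (Classical.arbitrary X)).anti (Set.empty_subset _)) h1
  rw [next, if_pos (Nat.even_iff.2 hh)]

theorem makerWinsSecond_of_makerWinsFrom [Fintype X] [Nonempty X]
    (h1 : ∀ x, MakerWinsFrom F ∅ {x}) : MakerWinsSecond F := by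
  refine ⟨makerStrategy F 1 0, fun σ => ?_⟩
  rw [secondClaims_eq]
  refine exists_subset_claims (e' := 0) rfl (fun h hh => ?_)
    ((h1 (Classical.arbitrary X)).anti (Set.empty_subset _)) h1
  rw [next, if_neg (Nat.not_even_iff.2 hh)]

end Maker

/-! ### Pairing strategies for Breaker. -/

section Pairing

variable {X : Type*} {F : Set (Set X)}

/-- The pairing strategy: answer the last move `v` with its partner `f v`. -/
noncomputable def pairingStrategy [Nonempty X] (f : X → X) : Strategy X :=
  Strategy.ofRule fun h x => ∃ v, h.head? = some v ∧ x = f v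

theorem not_exists_subset_claims_of_pairing [Fintype X] [Nonempty X] {f : X → X}
    (hf : ∀ x, f (f x) = x) (hne : ∀ x, f x ≠ x) (hF : ∀ A ∈ F, ∃ x ∈ A, f x ∈ A)
    {e e' : ℕ} (hee : e + e' = 1) {σ τ : Strategy X}
    (hnext : ∀ h : List X, h.length % 2 = e → next σ τ h = (pairingStrategy f).move h) :
    ¬ ∃ A ∈ F, A ⊆ claims e' (play σ τ (Fintype.card X)) := by
  -- The partner of each element claimed by Maker belongs to Breaker, except that just after Maker's
  -- move the partner of that last element may still be free. A Breaker move without a free partner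
  -- to answer is arbitrary and does no harm.
  have key : ∀ k ≤ Fintype.card X, ∀ v ∈ claims e' (play σ τ k),
      f v ∈ claims e (play σ τ k) ∨
      (k % 2 = e ∧ f v ∉ play σ τ k ∧ (play σ τ k).head? = some v) := by
    intro k hk
    induction k with
    | zero => exact fun v hv => hv.elim
    | succ k ih =>
      intro v hv
      have hlen := length_play σ τ k
      have hnm := next_play_notMem σ τ (k := k) (by omega)
      have hmem := fun x => mem_iff_mem_claims hee (h := play σ τ k) (x := x)
      have ih := ih (by omega)
      by_cases hpar : k % 2 = e
      · rw [play, claims_cons_of_ne _ (by omega)] at hv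
        rw [play, claims_cons_of_eq _ (by omega)]
        left
        rcases ih v hv with h | ⟨-, h1, h2⟩
        · exact Or.inr h
        · left
          obtain ⟨w, hw1, hw2⟩ := Strategy.ofRule_good
            (good := fun h x => ∃ v, h.head? = some v ∧ x = f v) h1 ⟨v, h2, rfl⟩
          rw [hnext _ (by omega), pairingStrategy, hw2]
          rw [h2] at hw1
          rw [Option.some.inj hw1]
      · rw [play, claims_cons_of_eq _ (by omega)] at hv
        rw [play, claims_cons_of_ne _ (by omega)]
        rcases hv with rfl | hv
        · by_cases hfv : f (next σ τ (play σ τ k)) ∈ play σ τ k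
          · left
            rcases (hmem _).1 hfv with h | h
            · exact h
            · rcases ih _ h with h | ⟨h, -⟩
              · rw [hf] at h
                exact (hnm (mem_of_mem_claims h)).elim
              · exact (hpar h).elim
          · exact Or.inr ⟨by omega, by simp [hfv, hne], rfl⟩
        · rcases ih v hv with h | ⟨h, -⟩
          · exact Or.inl h
          · exact (hpar h).elim
  rintro ⟨A, hA, hs⟩
  obtain ⟨x, hx, hfx⟩ := hF A hA
  rcases key _ le_rfl x (hs hx) with h | ⟨-, h, -⟩
  · exact not_mem_claims_of_nodup hee (nodup_play σ τ le_rfl) h (hs hfx)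
  · exact h (mem_play_card σ τ _)

theorem breakerWinsFirst_of_pairing [Fintype X] [Nonempty X] {f : X → X}
    (hf : ∀ x, f (f x) = x) (hne : ∀ x, f x ≠ x) (hF : ∀ A ∈ F, ∃ x ∈ A, f x ∈ A) :
    BreakerWinsFirst F := by
  refine ⟨pairingStrategy f, fun τ => ?_⟩
  rw [secondClaims_eq]
  refine not_exists_subset_claims_of_pairing hf hne hF (e := 0) rfl fun h hh => ?_
  rw [next, if_pos (Nat.even_iff.2 hh)]

theorem breakerWinsSecond_of_pairing [Fintype X] [Nonempty X] {f : X → X}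
    (hf : ∀ x, f (f x) = x) (hne : ∀ x, f x ≠ x) (hF : ∀ A ∈ F, ∃ x ∈ A, f x ∈ A) :
    BreakerWinsSecond F := by
  refine ⟨pairingStrategy f, fun σ => ?_⟩
  rw [firstClaims_eq]
  refine not_exists_subset_claims_of_pairing hf hne hF (e := 1) rfl fun h hh => ?_
  rw [next, if_neg (Nat.not_even_iff.2 hh)]

end Pairing

end MakerBreaker

/-! ### Maker wins on a necklace. -/

namespace MakerBreaker

/-- A cyclic configuration of winning sets: `k` pairwise disjoint triples `{l i, r i, p i}` and
one more element `q`, such that `r i, p (i + 1), r (i + 1)` and `l i, p i, l (i + 1)` form winning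
sets for all `i` modulo `k`, and so do `l 0, r 0, q`. -/
structure IsNecklace {X : Type*} (F : Set (Set X)) (k : ℕ) (l r p : ℕ → X) (q : X) : Prop where
  two_le : 2 ≤ k
  l_inj : ∀ i < k, ∀ j < k, l i = l j → i = j
  r_inj : ∀ i < k, ∀ j < k, r i = r j → i = j
  p_inj : ∀ i < k, ∀ j < k, p i = p j → i = j
  l_ne_r : ∀ i < k, ∀ j < k, l i ≠ r j
  l_ne_p : ∀ i < k, ∀ j < k, l i ≠ p j
  r_ne_p : ∀ i < k, ∀ j < k, r i ≠ p j
  q_ne : ∀ i < k, q ≠ l i ∧ q ≠ r i ∧ q ≠ p i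
  r_mem : ∀ i, i + 1 < k → {r i, p (i + 1), r (i + 1)} ∈ F
  l_mem : ∀ i, i + 1 < k → {l i, p i, l (i + 1)} ∈ F
  r_last_mem : {r (k - 1), p 0, r 0} ∈ F
  l_last_mem : {l (k - 1), p (k - 1), l 0} ∈ F
  q_mem : {l 0, r 0, q} ∈ F

namespace IsNecklace

variable {X : Type*} {F : Set (Set X)} {n : ℕ} {l r p : ℕ → X} {q : X} {B : Set X}

/-- Maker plays `l 0`, forcing `q`, then `l 1, …, l n`, forcing `p 0, …, p (n - 1)`; finally `l (n +
1)` threatens both `p n` and `p (n + 1)`. -/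
theorem makerWinsFrom_insert_r_last (N : IsNecklace F (n + 2) l r p q)
    (hB : ∀ i < n + 2, l i ∉ B ∧ r i ∉ B ∧ p i ∉ B) (hq : q ∉ B) :
    MakerWinsFrom F {r 0} (insert (r (n + 1)) B) := by
  obtain ⟨hk, hl, hr, hp, hlr, hlp, hrp, hqn, hR, hL, hR0, hL0, hQ⟩ := N
  simp only [show n + 2 - 1 = n + 1 from rfl] at hR0 hL0
  have t0 : 0 < n + 2 := by omega
  have t1 : 1 < n + 2 := by omega
  have tn : n < n + 2 := by omega
  have tn1 : n + 1 < n + 2 := by omega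
  have hL1 := hL n tn1
  refine .force (x := l 0) (y := q) hQ ?_ ?_ ?_ ?_ ?_ ?_ ?_
  · rintro z (rfl | rfl | rfl) <;> simp
  · simp only [Set.mem_singleton_iff]; grind
  · simp only [Set.mem_insert_iff]; grind
  · simp only [Set.mem_singleton_iff]; grind
  · simp only [Set.mem_insert_iff]; grind
  · grind
  refine .chain (a := l) (b := p) (m := n) (by simp) (fun i hi => hL i (by omega)) ?_ ?_ ?_ ?_ ?_ ?_
  · intro i hi
    simp only [Set.mem_insert_iff, Set.mem_singleton_iff]
    grind
  · intro i hi
    simp only [Set.mem_insert_iff, Set.mem_singleton_iff]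
    grind
  · grind
  · grind
  · grind
  refine .double (x := l (n + 1)) (y := p n) (y' := p (n + 1)) hL1 ?_ hL0 ?_ ?_ ?_ ?_ ?_ ?_ ?_ ?_ ?_ ?_
  · rintro z (rfl | rfl | rfl)
    · rcases n with _ | n
      · simp
      · exact .inr (.inr (.inr ⟨n, by omega, rfl⟩))
    · simp
    · simp
  · rintro z (rfl | rfl | rfl) <;> simp
  all_goals
    try simp only [Set.mem_union, Set.mem_insert_iff, Set.mem_singleton_iff, Set.mem_ofPred_eq]
    grind

/-- Maker plays `r 1, …, r n`, forcing `p 1, …, p n`, and then `p (n + 1)`, forcing `r (n + 1)`.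
Owning `p (n + 1)` makes `l 0` a double threat, at `l (n + 1)` and `q`. -/
theorem makerWinsFrom_insert_p_zero (N : IsNecklace F (n + 2) l r p q)
    (hB : ∀ i < n + 2, l i ∉ B ∧ r i ∉ B ∧ p i ∉ B) (hq : q ∉ B) :
    MakerWinsFrom F {r 0} (insert (p 0) B) := by
  obtain ⟨hk, hl, hr, hp, hlr, hlp, hrp, hqn, hR, hL, hR0, hL0, hQ⟩ := N
  simp only [show n + 2 - 1 = n + 1 from rfl] at hR0 hL0
  have t0 : 0 < n + 2 := by omega
  have t1 : 1 < n + 2 := by omega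
  have tn : n < n + 2 := by omega
  have tn1 : n + 1 < n + 2 := by omega
  have hR1 := hR n tn1
  refine .chain (a := r) (b := fun i => p (i + 1)) (m := n) (by simp)
    (fun i hi => hR i (by omega)) ?_ ?_ ?_ ?_ ?_ ?_
  · intro i hi
    simp only [Set.mem_insert_iff, Set.mem_singleton_iff]
    grind
  · intro i hi
    simp only [Set.mem_insert_iff, Set.mem_singleton_iff]
    grind
  · grind
  · grind
  · grind
  refine .force (x := p (n + 1)) (y := r (n + 1)) hR1 ?_ ?_ ?_ ?_ ?_ ?_ ?_
  · rintro z (rfl | rfl | rfl)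
    · rcases n with _ | n
      · simp
      · exact .inr (.inr (.inr ⟨n, by omega, rfl⟩))
    · simp
    · simp
  iterate 5
    · try simp only [Set.mem_union, Set.mem_insert_iff, Set.mem_singleton_iff, Set.mem_ofPred_eq]
      grind
  refine .double (x := l 0) (y := l (n + 1)) (y' := q) hL0 ?_ hQ ?_ ?_ ?_ ?_ ?_ ?_ ?_ ?_ ?_ ?_
  · rintro z (rfl | rfl | rfl) <;> simp
  · rintro z (rfl | rfl | rfl) <;> simp
  all_goals
    try simp only [Set.mem_union, Set.mem_insert_iff, Set.mem_singleton_iff, Set.mem_ofPred_eq]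
    grind

/-- The winning sets made of `r`s and `p`s are untouched: Maker runs through all the `r i`, and `r
(n + 1)` threatens both `p (n + 1)` and `p 0`. -/
theorem makerWinsFrom_insert_l_or_q (N : IsNecklace F (n + 2) l r p q)
    (hB : ∀ i < n + 2, l i ∉ B ∧ r i ∉ B ∧ p i ∉ B) {y : X}
    (hy : y = l 0 ∨ y = l 1 ∨ y = q) :
    MakerWinsFrom F {r 0} (insert y B) := by
  obtain ⟨hk, hl, hr, hp, hlr, hlp, hrp, hqn, hR, hL, hR0, hL0, hQ⟩ := N
  simp only [show n + 2 - 1 = n + 1 from rfl] at hR0 hL0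
  have t0 : 0 < n + 2 := by omega
  have t1 : 1 < n + 2 := by omega
  have tn : n < n + 2 := by omega
  have tn1 : n + 1 < n + 2 := by omega
  have hR1 := hR n tn1
  refine .chain (a := r) (b := fun i => p (i + 1)) (m := n) (by simp)
    (fun i hi => hR i (by omega)) ?_ ?_ ?_ ?_ ?_ ?_
  · intro i hi
    simp only [Set.mem_insert_iff, Set.mem_singleton_iff]
    grind
  · intro i hi
    simp only [Set.mem_insert_iff, Set.mem_singleton_iff]
    grind
  · grind
  · grind
  · grind
  refine .double (x := r (n + 1)) (y := p (n + 1)) (y' := p 0) hR1 ?_ hR0 ?_ ?_ ?_ ?_ ?_ ?_ ?_ ?_ ?_ ?_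
  · rintro z (rfl | rfl | rfl)
    · rcases n with _ | n
      · simp
      · exact .inr (.inr (.inr ⟨n, by omega, rfl⟩))
    · simp
    · simp
  · rintro z (rfl | rfl | rfl) <;> simp
  all_goals
    try simp only [Set.mem_union, Set.mem_insert_iff, Set.mem_singleton_iff, Set.mem_ofPred_eq]
    grind

/-- Maker plays `p 0`, forcing `r (n + 1)`; then `l 0` threatens both `l 1` and `q`. -/
theorem makerWinsFrom_insert_of_ne (N : IsNecklace F (n + 2) l r p q)
    (hB : ∀ i < n + 2, l i ∉ B ∧ r i ∉ B ∧ p i ∉ B) (hq : q ∉ B) {y : X}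
    (hy1 : y ≠ r (n + 1)) (hy2 : y ≠ p 0) (hy3 : y ≠ l 0 ∧ y ≠ l 1 ∧ y ≠ q) :
    MakerWinsFrom F {r 0} (insert y B) := by
  obtain ⟨hk, hl, hr, hp, hlr, hlp, hrp, hqn, hR, hL, hR0, hL0, hQ⟩ := N
  simp only [show n + 2 - 1 = n + 1 from rfl] at hR0 hL0
  have t0 : 0 < n + 2 := by omega
  have t1 : 1 < n + 2 := by omega
  have tn : n < n + 2 := by omega
  have tn1 : n + 1 < n + 2 := by omega
  have hL01 := hL 0 t1
  refine .force (x := p 0) (y := r (n + 1)) hR0 ?_ ?_ ?_ ?_ ?_ ?_ ?_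
  · rintro z (rfl | rfl | rfl) <;> simp
  iterate 5
    · try simp only [Set.mem_insert_iff, Set.mem_singleton_iff]
      grind
  refine .double (x := l 0) (y := l 1) (y' := q) hL01 ?_ hQ ?_ ?_ ?_ ?_ ?_ ?_ ?_ ?_ ?_ ?_
  · rintro z (rfl | rfl | rfl) <;> simp
  · rintro z (rfl | rfl | rfl) <;> simp
  all_goals
    try simp only [Set.mem_insert_iff, Set.mem_singleton_iff]
    grind

theorem makerWinsFrom {k : ℕ} (N : IsNecklace F k l r p q)
    (hB : ∀ i < k, l i ∉ B ∧ r i ∉ B ∧ p i ∉ B) (hq : q ∉ B) : MakerWinsFrom F ∅ B := by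
  obtain ⟨n, rfl⟩ : ∃ n, k = n + 2 := ⟨k - 2, by have := N.two_le; omega⟩
  have t0 : 0 < n + 2 := by omega
  refine .move (x := r 0) (Set.notMem_empty _) (hB 0 t0).2.1
    ⟨l 0, by simpa using N.l_ne_r 0 t0 0 t0, (hB 0 t0).1⟩ fun y hy hyB => ?_
  rw [show insert (r 0) (∅ : Set X) = {r 0} by simp]
  by_cases hy1 : y = r (n + 1)
  · exact hy1 ▸ N.makerWinsFrom_insert_r_last hB hq
  by_cases hy2 : y = p 0
  · exact hy2 ▸ N.makerWinsFrom_insert_p_zero hB hq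
  by_cases hy3 : y = l 0 ∨ y = l 1 ∨ y = q
  · exact N.makerWinsFrom_insert_l_or_q hB hy3
  · push Not at hy3
    exact N.makerWinsFrom_insert_of_ne hB hq hy1 hy2 hy3

end IsNecklace

end MakerBreaker

/-! ### Short cycles in the contracted multigraph. -/

/-- Given a colouring `c` and a map `m` of the elements of `V`, the elements `r 0, …, r (k - 1)`
have pairwise different colours, and `m (r i)` and `r (i + 1)` (with `i` modulo `k`) are different
elements of the same colour. -/
structure IsCircuit {V ι : Type*} (c : V → ι) (m : V → V) (k : ℕ) (r : ℕ → V) : Prop where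
  two_le : 2 ≤ k
  color_succ : ∀ i, i + 1 < k → c (m (r i)) = c (r (i + 1))
  ne_succ : ∀ i, i + 1 < k → m (r i) ≠ r (i + 1)
  color_last : c (m (r (k - 1))) = c (r 0)
  ne_last : m (r (k - 1)) ≠ r 0
  color_inj : ∀ i < k, ∀ j < k, c (r i) = c (r j) → i = j

section Circuit

variable {V ι : Type*} {c : V → ι} {m : V → V}

/-- A walk that never turns back along the edge it arrived by must repeat a colour; the stretch
between two equal colours at the smallest possible distance is a circuit. -/
theorem exists_isCircuit_of_forall_exists [Finite V] (hm : ∀ v, m (m v) = v)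
    (hcm : ∀ v, c (m v) ≠ c v) {D : V → Prop} {d : V} (hd : D d)
    (hs : ∀ v, D v → ∃ w, D w ∧ c (m v) = c w ∧ m v ≠ w) :
    ∃ k r, IsCircuit c m k r ∧ ∀ i, D (r i) := by
  choose! s hsD hsc hsne using hs
  let f : ℕ → V := fun i => s^[i] d
  have hf : ∀ i, f (i + 1) = s (f i) := fun i => Function.iterate_succ_apply' s i d
  have hfD : ∀ i, D (f i) := by
    intro i
    induction i with
    | zero => exact hd
    | succ i ih => exact hf i ▸ hsD _ ih
  have hfc : ∀ i, c (m (f i)) = c (f (i + 1)) := fun i => hf i ▸ hsc _ (hfD i)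
  have hfne : ∀ i, m (f i) ≠ f (i + 1) := fun i => hf i ▸ hsne _ (hfD i)
  have hex : ∃ g, 0 < g ∧ ∃ i, c (f i) = c (f (i + g)) := by
    obtain ⟨i, j, hij, h⟩ := Finite.exists_ne_map_eq_of_infinite f
    rcases lt_or_gt_of_ne hij with hij | hij
    · exact ⟨j - i, by omega, i, by rw [h]; congr 2; omega⟩
    · exact ⟨i - j, by omega, j, by rw [← h]; congr 2; omega⟩
  classical
  obtain ⟨hk, i, hi⟩ := Nat.find_spec hex
  have hmin : ∀ a b, a < b → b - a < Nat.find hex → c (f a) ≠ c (f b) := by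
    intro a b hab hlt h
    exact Nat.find_min hex hlt ⟨by omega, a, by rw [h]; congr 2; omega⟩
  generalize Nat.find hex = k at hk hi hmin
  have hk2 : 2 ≤ k := by
    by_contra hk2
    obtain rfl : k = 1 := by omega
    exact hcm (f i) ((hfc i).trans hi.symm)
  refine ⟨k, fun t => f (i + t), ⟨hk2, fun t _ => hfc _, fun t _ => hfne _, ?_, ?_, ?_⟩,
    fun t => hfD _⟩
  · rw [hfc, show i + (k - 1) + 1 = i + k by omega, ← hi, add_zero]
  · intro h
    have h' : f (i + (k - 1)) = m (f i) := by rw [← hm (f (i + (k - 1))), h, add_zero]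
    rcases Nat.eq_or_lt_of_le hk2 with rfl | hk3
    · exact hfne i h'.symm
    -- Closing up along the first edge would repeat the colour of `f (i + 1)` at distance `k - 2`.
    · refine hmin (i + 1) (i + (k - 1)) (by omega) (by omega) ?_
      rw [h', hfc]
  · intro a ha b hb h
    rcases lt_trichotomy a b with hab | hab | hab
    · exact (hmin _ _ (by omega) (by omega) h).elim
    · exact hab
    · exact (hmin _ _ (by omega) (by omega) h.symm).elim

/-- The usual peeling: `hU` says that `U` spans at least as many edges as vertices, every edge being
counted at both ends. Deleting a vertex of degree at most one preserves this, so the process stops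
at a nonempty part of minimum degree two. -/
theorem exists_core [Fintype V] [DecidableEq V] [DecidableEq ι] (hm : ∀ v, m (m v) = v)
    (hcm : ∀ v, c (m v) ≠ c v) (U : Finset ι) (hne : U.Nonempty)
    (hU : 2 * U.card ≤ (Finset.univ.filter fun v => c v ∈ U ∧ c (m v) ∈ U).card) :
    ∃ W ⊆ U, W.Nonempty ∧
      ∀ t ∈ W, 1 < (Finset.univ.filter fun v => c v = t ∧ c (m v) ∈ W).card := by
  induction hn : U.card generalizing U with
  | zero => simp [Finset.card_eq_zero.1 hn] at hne
  | succ n ih =>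
    by_cases hall : ∀ t ∈ U, 1 < (Finset.univ.filter fun v => c v = t ∧ c (m v) ∈ U).card
    · exact ⟨U, subset_rfl, hne, hall⟩
    push Not at hall
    obtain ⟨t, ht, hcard⟩ := hall
    set A := Finset.univ.filter fun v => c v = t ∧ c (m v) ∈ U
    have hsub : (Finset.univ.filter fun v => c v ∈ U ∧ c (m v) ∈ U) ⊆
        (Finset.univ.filter fun v => c v ∈ U.erase t ∧ c (m v) ∈ U.erase t) ∪ (A ∪ A.image m) := by
      intro v hv
      simp only [A, Finset.mem_filter, Finset.mem_univ, true_and, Finset.mem_union,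
        Finset.mem_erase, Finset.mem_image] at hv ⊢
      by_cases h1 : c v = t
      · exact .inr (.inl ⟨h1, hv.2⟩)
      · by_cases h2 : c (m v) = t
        · exact .inr (.inr ⟨m v, ⟨h2, by rw [hm]; exact hv.1⟩, hm v⟩)
        · exact .inl ⟨⟨h1, hv.1⟩, h2, hv.2⟩
    have h1 := Finset.card_le_card hsub
    have h2 := Finset.card_union_le
      (Finset.univ.filter fun v => c v ∈ U.erase t ∧ c (m v) ∈ U.erase t) (A ∪ A.image m)
    have h3 := Finset.card_union_le A (A.image m)
    have h4 : (A.image m).card ≤ A.card := Finset.card_image_le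
    have h5 := Finset.card_erase_of_mem ht
    -- A single colour spans no edge by `hcm`, which contradicts the count.
    have hne' : (U.erase t).Nonempty := by
      rw [Finset.nonempty_iff_ne_empty]
      intro he
      have hempty : (Finset.univ.filter fun v => c v ∈ U ∧ c (m v) ∈ U) = ∅ := by
        refine Finset.filter_eq_empty_iff.2 fun v _ hv => hcm v ?_
        rw [Finset.erase_eq_empty_iff] at he
        rcases he with rfl | rfl
        · simp at ht
        · rw [Finset.mem_singleton.1 hv.1, Finset.mem_singleton.1 hv.2]
      rw [hempty, Finset.card_empty] at hU
      omega
    obtain ⟨W, hW, h⟩ := ih (U.erase t) hne' (by omega) (by omega)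
    exact ⟨W, hW.trans (Finset.erase_subset _ _), h⟩

/-- With `t` triangles, deleting that of `x` leaves at least `3 * t - 6` edge ends on `t - 1`
triangles, and `3 * t - 6 ≥ 2 * (t - 1)` exactly when `t ≥ 4`. -/
theorem exists_isCircuit_avoiding [Fintype V] [DecidableEq V] [DecidableEq ι]
    (hm : ∀ v, m (m v) = v) (hcm : ∀ v, c (m v) ≠ c v) (U : Finset ι) (hU : ∀ v, c v ∈ U)
    (h3 : ∀ t ∈ U, (Finset.univ.filter fun v => c v = t).card = 3) (h4 : 4 ≤ U.card) (x : V) :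
    ∃ k r, IsCircuit c m k r ∧ ∀ i, c (r i) ≠ c x := by
  have hcard : Fintype.card V = U.card * 3 := by
    rw [← Finset.card_univ, Finset.card_eq_sum_card_fiberwise (f := c) (t := U) fun v _ => hU v]
    exact Finset.sum_const_nat h3
  set A := Finset.univ.filter fun v => c v = c x
  have hA : A.card = 3 := h3 _ (hU x)
  have hsub : (Finset.univ : Finset V) ⊆
      (Finset.univ.filter fun v => c v ∈ U.erase (c x) ∧ c (m v) ∈ U.erase (c x)) ∪
        (A ∪ A.image m) := by
    intro v _
    simp only [A, Finset.mem_filter, Finset.mem_univ, true_and, Finset.mem_union,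
      Finset.mem_erase, Finset.mem_image]
    by_cases h1 : c v = c x
    · exact .inr (.inl h1)
    · by_cases h2 : c (m v) = c x
      · exact .inr (.inr ⟨m v, h2, hm v⟩)
      · exact .inl ⟨⟨h1, hU _⟩, h2, hU _⟩
  have h5 := Finset.card_le_card hsub
  have h6 := Finset.card_union_le
    (Finset.univ.filter fun v => c v ∈ U.erase (c x) ∧ c (m v) ∈ U.erase (c x)) (A ∪ A.image m)
  have h7 := Finset.card_union_le A (A.image m)
  have h8 : (A.image m).card ≤ A.card := Finset.card_image_le
  have h9 := Finset.card_erase_of_mem (hU x)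
  rw [Finset.card_univ] at h5
  obtain ⟨W, hW, ⟨t, ht⟩, hW2⟩ := exists_core hm hcm (U.erase (c x))
    (Finset.card_pos.1 (by omega)) (by omega)
  obtain ⟨d, hd⟩ := Finset.card_pos.1 (pos_of_gt (hW2 t ht))
  simp only [Finset.mem_filter, Finset.mem_univ, true_and] at hd
  obtain ⟨k, r, hr, hrD⟩ := exists_isCircuit_of_forall_exists hm hcm
    (D := fun v => c v ∈ W ∧ c (m v) ∈ W) (d := d) ⟨hd.1 ▸ ht, hd.2⟩ fun v hv => by
      obtain ⟨w, hw, hwne⟩ := Finset.exists_mem_ne (hW2 _ hv.2) (m v)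
      simp only [Finset.mem_filter, Finset.mem_univ, true_and] at hw
      exact ⟨w, ⟨hw.1 ▸ hv.2, hw.2⟩, hw.1.symm, hwne.symm⟩
  exact ⟨k, r, hr, fun i => Finset.ne_of_mem_erase (hW (hrD i).1)⟩

/-- In a shortest circuit avoiding the colour of `x`, the third element `p` coloured like `r 0`
is mapped outside of the colours of the circuit. -/
theorem IsCircuit.color_ne_of_minimal {k : ℕ} {r : ℕ → V} (hr : IsCircuit c m k r)
    (hm : ∀ v, m (m v) = v) (hcm : ∀ v, c (m v) ≠ c v) {x : V} (hx : ∀ i < k, c (r i) ≠ c x)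
    (hmin : ∀ k' < k, ∀ r', IsCircuit c m k' r' → ∃ i < k', c (r' i) = c x)
    (h3 : ∀ u v w y, u ≠ v → u ≠ w → v ≠ w → c v = c u → c w = c u → c y = c u →
      y = u ∨ y = v ∨ y = w)
    (hconn : ∀ S : Set V, S.Nonempty → (∀ v ∈ S, m v ∈ S) →
      (∀ v w, c v = c w → v ∈ S → w ∈ S) → ∀ v, v ∈ S)
    {p : V} (hp : c p = c (r 0)) (hp1 : p ≠ r 0) (hp2 : p ≠ m (r (k - 1))) :
    ∀ j < k, c (m p) ≠ c (r j) := by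
  obtain ⟨hk, hcs, hns, hcl, hnl, hinj⟩ := hr
  intro j hj hpj
  have hj0 : j ≠ 0 := by
    rintro rfl
    exact hcm p (hpj.trans hp.symm)
  have hpr : m p ≠ r j := by
    intro h
    have h' : p = m (r j) := by rw [← h, hm]
    by_cases hjk : j + 1 < k
    · have := hinj _ hjk 0 (by omega) (by rw [← hcs j hjk, ← h', hp])
      omega
    · exact hp2 (h'.trans (by congr 2; omega))
  -- A chord from `p` to a later colour gives the shorter circuit `p, r j, …, r (k - 1)`.
  have hj1 : j = 1 := by
    by_contra hj1
    obtain ⟨i, hi, h⟩ := hmin (k - j + 1) (by omega) (fun i => if i = 0 then p else r (j + i - 1)) <|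
      { two_le := by omega
        color_succ := by
          rintro (_ | i) hi
          · simpa using hpj
          · simp only [Nat.add_eq_zero_iff, one_ne_zero, and_false, if_false]
            rw [show j + (i + 1) - 1 = j + i by omega, hcs _ (by omega)]
            congr 2
        ne_succ := by
          rintro (_ | i) hi
          · simpa using hpr
          · simp only [Nat.add_eq_zero_iff, one_ne_zero, and_false, if_false]
            exact hns _ (by omega)
        color_last := by
          have : j + (k - j + 1 - 1) - 1 = k - 1 := by omega
          rw [if_neg (by omega), if_pos rfl, this, hcl, hp]
        ne_last := by
          have : j + (k - j + 1 - 1) - 1 = k - 1 := by omega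
          rw [if_neg (by omega), if_pos rfl, this]
          exact hp2.symm
        color_inj := by
          rintro (_ | a) ha (_ | b) hb h
          · rfl
          · simp only [if_true, Nat.add_eq_zero_iff, one_ne_zero, and_false, if_false] at h
            have := hinj 0 (by omega) _ (by omega) (hp.symm.trans h)
            omega
          · simp only [if_true, Nat.add_eq_zero_iff, one_ne_zero, and_false, if_false] at h
            have := hinj _ (by omega) 0 (by omega) (h.trans hp)
            omega
          · simp only [Nat.add_eq_zero_iff, one_ne_zero, and_false, if_false] at h
            have := hinj _ (by omega) _ (by omega) h
            omega }
    rcases i with _ | i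
    · exact hx 0 (by omega) (hp ▸ h)
    · exact hx _ (by omega) h
  subst hj1
  -- Now `r 0` and `p` both lead to the colour of `r 1`, and these two parallel edges form a circuit
  -- of length two.
  have hk2 : k = 2 := by
    by_contra hk2
    obtain ⟨i, hi, h⟩ := hmin 2 (by omega) (fun i => if i = 0 then r 0 else m p) <|
      { two_le := le_rfl
        color_succ := by
          intro i hi
          obtain rfl : i = 0 := by omega
          simpa using (hcs 0 hj).trans hpj.symm
        ne_succ := by
          intro i hi h
          obtain rfl : i = 0 := by omega
          simp only [if_true, zero_add, one_ne_zero, if_false] at h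
          exact hp1 (by rw [← hm p, ← h, hm])
        color_last := by simpa [hm] using hp
        ne_last := by simpa [hm] using hp1
        color_inj := by
          intro a ha b hb h
          have h01 : c (r 0) ≠ c (m p) := fun h => hcm p (h.symm.trans hp.symm)
          rcases a with _ | _ | a <;> rcases b with _ | _ | b <;> first | omega | simp_all }
    rcases i with _ | i
    · exact hx 0 (by omega) h
    · exact hx 1 hj (hpj ▸ h)
  subst hk2
  simp only [Nat.add_one_sub_one] at hcl hnl hp2
  have hcs := hcs 0 hj
  have hns := hns 0 hj
  rw [zero_add] at hcs hns
  have hx0 := hx 0 (by omega)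
  have hx1 := hx 1 hj
  -- Three parallel edges join the two colours, so they make up a whole component, yet `x` lies
  -- outside.
  have hmem := hconn {v | c v = c (r 0) ∨ c v = c (r 1)} ⟨r 0, Or.inl rfl⟩ ?_
    (fun v w h hv => by rcases hv with hv | hv; exacts [Or.inl (h ▸ hv), Or.inr (h ▸ hv)]) x
  · rcases hmem with h | h
    · exact hx0 h.symm
    · exact hx1 h.symm
  · rintro v (hv | hv)
    · rcases h3 (r 0) p (m (r 1)) v hp1.symm hnl.symm hp2 hp hcl hv with rfl | rfl | rfl
      · exact Or.inr hcs
      · exact Or.inr hpj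
      · exact Or.inr (by rw [hm])
    · rcases h3 (r 1) (m p) (m (r 0)) v hpr.symm hns.symm
        (fun h => hp1 (by rw [← hm p, h, hm])) hpj hcs hv with rfl | rfl | rfl
      · exact Or.inl hcl
      · exact Or.inl (by rw [hm, hp])
      · exact Or.inl (by rw [hm])

theorem IsCircuit.rotate {k : ℕ} {r : ℕ → V} (hr : IsCircuit c m k r) :
    IsCircuit c m k fun i => if i + 1 < k then r (i + 1) else r 0 := by
  obtain ⟨hk, hcs, hns, hcl, hnl, hinj⟩ := hr
  refine ⟨hk, fun i hi => ?_, fun i hi => ?_, ?_, ?_, fun i hi j hj h => ?_⟩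
  · rw [if_pos hi]
    split_ifs with h
    · exact hcs _ h
    · rw [← hcl]
      congr 3
      omega
  · rw [if_pos hi]
    split_ifs with h
    · exact hns _ h
    · rw [show i + 1 = k - 1 by omega]
      exact hnl
  · rw [if_neg (by omega), if_pos (by omega)]
    exact hcs 0 (by omega)
  · rw [if_neg (by omega), if_pos (by omega)]
    exact hns 0 (by omega)
  · split_ifs at h with h1 h2 h2
    · have := hinj _ h1 _ h2 h
      omega
    · have := hinj _ h1 _ (by omega) h
      omega
    · have := hinj _ (by omega) _ h2 h
      omega
    · omega

theorem exists_isCircuit_with_free_pendant [Fintype V] [DecidableEq V] [DecidableEq ι]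
    (hm : ∀ v, m (m v) = v) (hcm : ∀ v, c (m v) ≠ c v) (U : Finset ι) (hU : ∀ v, c v ∈ U)
    (hU3 : ∀ t ∈ U, (Finset.univ.filter fun v => c v = t).card = 3) (h4 : 4 ≤ U.card)
    (h3 : ∀ u v w y, u ≠ v → u ≠ w → v ≠ w → c v = c u → c w = c u → c y = c u →
      y = u ∨ y = v ∨ y = w)
    (hconn : ∀ S : Set V, S.Nonempty → (∀ v ∈ S, m v ∈ S) →
      (∀ v w, c v = c w → v ∈ S → w ∈ S) → ∀ v, v ∈ S) (x : V) :
    ∃ k r, IsCircuit c m k r ∧ (∀ i < k, c (r i) ≠ c x) ∧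
      ∀ p, c p = c (r 0) → p ≠ r 0 → p ≠ m (r (k - 1)) →
        m p ≠ x ∧ ∀ j < k, c (m p) ≠ c (r j) := by
  classical
  have hex : ∃ k r, IsCircuit c m k r ∧ ∀ i < k, c (r i) ≠ c x := by
    obtain ⟨k, r, hr, h⟩ := exists_isCircuit_avoiding hm hcm U hU hU3 h4 x
    exact ⟨k, r, hr, fun i _ => h i⟩
  obtain ⟨r, hr, hx⟩ := Nat.find_spec hex
  have hmin : ∀ k' < Nat.find hex, ∀ r', IsCircuit c m k' r' → ∃ i < k', c (r' i) = c x := by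
    intro k' hk' r' hr'
    by_contra! h
    exact Nat.find_min hex hk' ⟨r', hr', h⟩
  generalize Nat.find hex = k at hr hx hmin
  have hk := hr.two_le
  by_cases hq : ∃ p, c p = c (r 0) ∧ p ≠ r 0 ∧ p ≠ m (r (k - 1)) ∧ m p = x
  · obtain ⟨p, hp, hp1, hp2, hpx⟩ := hq
    have hx' : ∀ i < k, c (if i + 1 < k then r (i + 1) else r 0) ≠ c x := by
      intro i hi
      split_ifs with h
      · exact hx _ h
      · exact hx 0 (by omega)
    -- Only one vertex is matched to `x`, and it has the colour of `r 0`; starting the circuit at `r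
    -- 1` avoids it.
    refine ⟨k, _, hr.rotate, hx', fun p' hp' hp1' hp2' => ⟨?_, ?_⟩⟩
    · rintro rfl
      have : p = p' := by rw [← hm p, hpx, hm]
      rw [if_pos (by omega)] at hp'
      have := hr.color_inj 0 (by omega) 1 (by omega) (by rw [← hp, this, hp'])
      omega
    · exact hr.rotate.color_ne_of_minimal hm hcm hx' hmin h3 hconn hp' hp1' hp2'
  · push Not at hq
    exact ⟨k, r, hr, hx, fun p hp hp1 hp2 =>
      ⟨hq p hp hp1 hp2, hr.color_ne_of_minimal hm hcm hx hmin h3 hconn hp hp1 hp2⟩⟩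

end Circuit

/-! ### The perfect matching between the triangles. -/

namespace SimpleGraph

variable {V : Type*} [Fintype V] [DecidableEq V] {G : SimpleGraph V} [DecidableRel G.Adj]

/-- In a cubic graph with a triangle-factor, every vertex has exactly one neighbour outside of its
triangle, and this defines an involution. -/
theorem exists_outer_neighbor (hcubic : G.IsRegularOfDegree 3)
    {P : Finpartition (Finset.univ : Finset V)} (hP : ∀ t ∈ P.parts, G.IsNClique 3 t) :
    ∃ m : V → V, (∀ v, m (m v) = v) ∧ (∀ v, P.part (m v) ≠ P.part v) ∧
      ∀ v w, G.Adj v w ↔ (P.part w = P.part v ∧ w ≠ v) ∨ w = m v := by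
  have hmem : ∀ v, v ∈ P.part v := fun v => P.mem_part (Finset.mem_univ v)
  have hiff : ∀ v w, w ∈ P.part v ↔ P.part w = P.part v := fun v w =>
    P.mem_part_iff_part_eq_part (Finset.mem_univ w) (Finset.mem_univ v)
  have hcl : ∀ v, G.IsNClique 3 (P.part v) := fun v => hP _ (P.part_mem.2 (Finset.mem_univ v))
  have hadj : ∀ v w, P.part w = P.part v → w ≠ v → G.Adj v w := fun v w h hne =>
    (hcl v).isClique (Finset.mem_coe.2 (hmem v)) (Finset.mem_coe.2 ((hiff v w).2 h)) hne.symm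
  have hout : ∀ v, ∃ w, G.neighborFinset v \ (P.part v).erase v = {w} := by
    intro v
    rw [← Finset.card_eq_one, Finset.card_sdiff_of_subset, Finset.card_erase_of_mem (hmem v),
      (hcl v).card_eq, card_neighborFinset_eq_degree, hcubic v]
    intro w hw
    obtain ⟨h1, h2⟩ := Finset.mem_erase.1 hw
    exact (G.mem_neighborFinset v w).2 (hadj v w ((hiff v w).1 h2) h1)
  choose m hm using hout
  have key : ∀ v w, G.Adj v w ∧ P.part w ≠ P.part v ↔ w = m v := by
    intro v w
    have h := Finset.ext_iff.1 (hm v) w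
    rw [Finset.mem_sdiff, mem_neighborFinset, Finset.mem_erase, hiff, Finset.mem_singleton] at h
    rw [← h]
    refine and_congr_right fun hvw => ?_
    have := hvw.ne'
    tauto
  refine ⟨m, fun v => ?_, fun v => ((key v (m v)).2 rfl).2, fun v w => ?_⟩
  · obtain ⟨h1, h2⟩ := (key v (m v)).2 rfl
    exact ((key (m v) v).1 ⟨h1.symm, h2.symm⟩).symm
  · rw [← key]
    refine ⟨fun h => ?_, ?_⟩
    · by_cases hp : P.part w = P.part v
      · exact Or.inl ⟨hp, h.ne'⟩
      · exact Or.inr ⟨h, hp⟩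
    · rintro (⟨h1, h2⟩ | h)
      · exact hadj v w h1 h2
      · exact h.1

end SimpleGraph

/-! ### From circuits to necklaces, and the pairing on the prism. -/

section Coloring

variable {V ι : Type*} [Fintype V] [DecidableEq V] [DecidableEq ι] {G : SimpleGraph V}
  {c : V → ι} {m : V → V}

theorem exists_third {t : ι} (h3 : (Finset.univ.filter fun v => c v = t).card = 3) {u v : V}
    (hu : c u = t) (hv : c v = t) (huv : u ≠ v) :
    ∃ w, w ≠ u ∧ w ≠ v ∧ ∀ y, c y = t ↔ y = u ∨ y = v ∨ y = w := by
  have h2 : (((Finset.univ.filter fun v => c v = t).erase u).erase v).card = 1 := by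
    rw [Finset.card_erase_of_mem (by simp [hv, huv.symm]),
      Finset.card_erase_of_mem (by simp [hu]), h3]
  obtain ⟨w, hw⟩ := Finset.card_eq_one.1 h2
  have key : ∀ y, (y ≠ v ∧ y ≠ u ∧ c y = t) ↔ y = w := fun y => by
    simpa using Finset.ext_iff.1 hw y
  obtain ⟨h1, h2, h3⟩ := (key w).2 rfl
  refine ⟨w, h2, h1, fun y => ⟨fun hy => ?_, ?_⟩⟩
  · have := key y
    tauto
  · rintro (rfl | rfl | rfl) <;> assumption

open MakerBreaker SimpleGraph

theorem makerWinsFrom_of_four_le (hconn : G.Connected) (hm : ∀ v, m (m v) = v)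
    (hcm : ∀ v, c (m v) ≠ c v) (hadj : ∀ v w, G.Adj v w ↔ (c w = c v ∧ w ≠ v) ∨ w = m v)
    (U : Finset ι) (hU : ∀ v, c v ∈ U)
    (hU3 : ∀ t ∈ U, (Finset.univ.filter fun v => c v = t).card = 3) (h4 : 4 ≤ U.card) (x : V) :
    MakerWinsFrom G.openNeighborhoods ∅ {x} := by
  obtain ⟨k, r, hr, hx, hfree⟩ := exists_isCircuit_with_free_pendant hm hcm U hU hU3 h4
    (fun u v w y huv huw hvw hv hw hy => by
      obtain ⟨z, -, -, hz⟩ := exists_third (hU3 _ (hU u)) rfl hv huv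
      have h1 := (hz w).1 hw
      have h2 := (hz y).1 hy
      grind)
    (fun S ⟨s, hs⟩ hSm hSc v => by
      obtain ⟨p⟩ := hconn.preconnected s v
      induction p with
      | nil => exact hs
      | cons h p ih =>
        refine ih ?_
        rcases (hadj _ _).1 h with ⟨h, -⟩ | rfl
        · exact hSc _ _ h.symm hs
        · exact hSm _ hs) x
  obtain ⟨hk, hcs, hns, hcl, hnl, hinj⟩ := hr
  -- In triangle `i` the circuit enters at `l i` and leaves at `r i`; `p i` will be the third
  -- vertex. The necklace sets are the neighbourhoods of all the `l i` and `r i`, and of `p 0`.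
  obtain ⟨l, hl0, hl⟩ : ∃ l : ℕ → V, l 0 = m (r (k - 1)) ∧ ∀ i, l (i + 1) = m (r i) :=
    ⟨fun i => Nat.casesOn i (m (r (k - 1))) fun i => m (r i), rfl, fun _ => rfl⟩
  have hlc : ∀ i < k, c (l i) = c (r i) := by
    rintro (_ | i) hi
    · rw [hl0, hcl]
    · rw [hl, hcs _ hi]
  have hlr : ∀ i < k, l i ≠ r i := by
    rintro (_ | i) hi
    · rw [hl0]
      exact hnl
    · rw [hl]
      exact hns _ hi
  have hthird : ∀ i, ∃ w, i < k →
      w ≠ l i ∧ w ≠ r i ∧ ∀ y, c y = c (r i) ↔ y = l i ∨ y = r i ∨ y = w := by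
    intro i
    by_cases hi : i < k
    · obtain ⟨w, hw⟩ := exists_third (hU3 _ (hU (r i))) (hlc i hi) rfl (hlr i hi)
      exact ⟨w, fun _ => hw⟩
    · exact ⟨l i, fun h => (hi h).elim⟩
  choose p hp using hthird
  have hpc : ∀ i < k, c (p i) = c (r i) := fun i hi => ((hp i hi).2.2 _).2 (Or.inr (Or.inr rfl))
  have hN : ∀ v, G.neighborSet v ∈ G.openNeighborhoods := fun v => ⟨v, rfl⟩
  have hNl : ∀ i < k, G.neighborSet (l i) = {m (l i), p i, r i} := by
    intro i hi
    ext y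
    obtain ⟨h1, h2, h3⟩ := hp i hi
    have := hlr i hi
    rw [mem_neighborSet, hadj, hlc i hi, h3]
    simp only [Set.mem_insert_iff, Set.mem_singleton_iff]
    grind
  have hNr : ∀ i < k, G.neighborSet (r i) = {l i, p i, m (r i)} := by
    intro i hi
    ext y
    obtain ⟨h1, h2, h3⟩ := hp i hi
    have := hlr i hi
    rw [mem_neighborSet, hadj, h3]
    simp only [Set.mem_insert_iff, Set.mem_singleton_iff]
    grind
  have hNp : ∀ i < k, G.neighborSet (p i) = {l i, r i, m (p i)} := by
    intro i hi
    ext y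
    obtain ⟨h1, h2, h3⟩ := hp i hi
    have := hlr i hi
    rw [mem_neighborSet, hadj, hpc i hi, h3]
    simp only [Set.mem_insert_iff, Set.mem_singleton_iff]
    grind
  have t0 : 0 < k := by omega
  obtain ⟨hqx, hq⟩ := hfree (p 0) (hpc 0 t0) (hp 0 t0).2.1 (hl0 ▸ (hp 0 t0).1)
  have hdisj : ∀ i < k, ∀ j < k, ∀ u v, c u = c (r i) → c v = c (r j) → u = v → i = j :=
    fun i hi j hj u v hu hv h => hinj i hi j hj (by rw [← hu, ← hv, h])
  have N : IsNecklace G.openNeighborhoods k l r p (m (p 0)) :=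
    { two_le := hk
      l_inj := fun i hi j hj => hdisj i hi j hj _ _ (hlc i hi) (hlc j hj)
      r_inj := fun i hi j hj => hdisj i hi j hj _ _ rfl rfl
      p_inj := fun i hi j hj => hdisj i hi j hj _ _ (hpc i hi) (hpc j hj)
      l_ne_r := fun i hi j hj h => by
        obtain rfl := hdisj i hi j hj _ _ (hlc i hi) rfl h
        exact hlr i hi h
      l_ne_p := fun i hi j hj h => by
        obtain rfl := hdisj i hi j hj _ _ (hlc i hi) (hpc j hj) h
        exact (hp i hi).1 h.symm
      r_ne_p := fun i hi j hj h => by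
        obtain rfl := hdisj i hi j hj _ _ rfl (hpc j hj) h
        exact (hp i hi).2.1 h.symm
      q_ne := fun i hi => ⟨fun h => hq i hi (by rw [h, hlc i hi]), fun h => hq i hi (by rw [h]),
        fun h => hq i hi (by rw [h, hpc i hi])⟩
      r_mem := fun i hi => by
        have := hNl (i + 1) hi
        rw [hl, hm] at this
        exact this ▸ hN _
      l_mem := fun i hi => by
        rw [hl, ← hNr i (by omega)]
        exact hN _
      r_last_mem := by
        have := hNl 0 t0
        rw [hl0, hm] at this
        exact this ▸ hN _
      l_last_mem := by
        rw [hl0, ← hNr (k - 1) (by omega)]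
        exact hN _
      q_mem := by
        rw [← hNp 0 t0]
        exact hN _ }
  refine N.makerWinsFrom (fun i hi => ⟨?_, ?_, ?_⟩) hqx
  · exact fun h => hx i hi (by rw [← hlc i hi, h])
  · exact fun h => hx i hi (by rw [h])
  · exact fun h => hx i hi (by rw [← hpc i hi, h])

theorem exists_pairing_of_card_eq_two (hm : ∀ v, m (m v) = v) (hcm : ∀ v, c (m v) ≠ c v)
    (hadj : ∀ v w, G.Adj v w ↔ (c w = c v ∧ w ≠ v) ∨ w = m v) (U : Finset ι)
    (hU : ∀ v, c v ∈ U) (hU3 : ∀ t ∈ U, (Finset.univ.filter fun v => c v = t).card = 3)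
    (h2 : U.card = 2) :
    ∃ f : V → V, (∀ v, f (f v) = v) ∧ (∀ v, f v ≠ v) ∧
      ∀ A ∈ G.openNeighborhoods, ∃ v ∈ A, f v ∈ A := by
  obtain ⟨s, t, hst, rfl⟩ := Finset.card_eq_two.1 h2
  obtain ⟨a, b, d, hab, had, hbd, hs⟩ := Finset.card_eq_three.1 (hU3 s (by simp))
  have hs : ∀ v, c v = s ↔ v = a ∨ v = b ∨ v = d := fun v => by
    simpa using Finset.ext_iff.1 hs v
  have hc : ∀ v, c v = s ∨ c v = t := fun v => by simpa using hU v
  have hca : c a = s := (hs a).2 (by simp)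
  have hcb : c b = s := (hs b).2 (by simp)
  have hcd : c d = s := (hs d).2 (by simp)
  have hmt : ∀ v, c v = s → c (m v) = t := fun v hv => (hc _).resolve_left (hv ▸ hcm v)
  have hma := hmt a hca
  have hmb := hmt b hcb
  have hmd := hmt d hcd
  have hall : ∀ v, v = a ∨ v = b ∨ v = d ∨ v = m a ∨ v = m b ∨ v = m d := by
    intro v
    rcases hc v with h | h
    · have := (hs v).1 h
      tauto
    · have := (hs (m v)).1 ((hc _).resolve_right (h ▸ hcm v))
      have := hm v
      grind
  have e1 : m a ≠ m b := fun h => hab (by rw [← hm a, h, hm])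
  have e2 : m a ≠ m d := fun h => had (by rw [← hm a, h, hm])
  have e3 : m b ≠ m d := fun h => hbd (by rw [← hm b, h, hm])
  have hne : ∀ u v, c u = s → c v = t → u ≠ v := fun u v hu hv h => hst (by rw [← hu, h, hv])
  have haa := hne a _ hca hma
  have hab' := hne a _ hca hmb
  have had' := hne a _ hca hmd
  have hba := hne b _ hcb hma
  have hbb := hne b _ hcb hmb
  have hbd' := hne b _ hcb hmd
  have hda := hne d _ hcd hma
  have hdb := hne d _ hcd hmb
  have hdd := hne d _ hcd hmd
  -- Each vertex of one triangle is paired with the match of the next in cyclic order. Thus `{a, m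
  -- b}` lies in the neighbourhoods of `b` and `m a`, and cyclically.
  obtain ⟨f, fa, fb, fd, fa', fb', fd'⟩ : ∃ f : V → V, f a = m b ∧ f b = m d ∧ f d = m a ∧
      f (m a) = d ∧ f (m b) = a ∧ f (m d) = b := by
    refine ⟨fun v => if v = a then m b else if v = b then m d else if v = d then m a else
      if v = m a then d else if v = m b then a else b, ?_⟩
    grind
  refine ⟨f, fun v => ?_, fun v => ?_, ?_⟩
  · rcases hall v with rfl | rfl | rfl | rfl | rfl | rfl <;> simp only [fa, fb, fd, fa', fb', fd']
  · rcases hall v with rfl | rfl | rfl | rfl | rfl | rfl <;>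
      simp only [fa, fb, fd, fa', fb', fd'] <;> simp only [ne_eq] <;> grind
  · rintro _ ⟨v, rfl⟩
    simp only [mem_neighborSet, hadj]
    rcases hall v with rfl | rfl | rfl | rfl | rfl | rfl
    · exact ⟨d, by grind⟩
    · exact ⟨a, by grind⟩
    · exact ⟨b, by grind⟩
    · exact ⟨m b, by grind⟩
    · exact ⟨m d, by grind⟩
    · exact ⟨m a, by grind⟩

end Coloring

/-! ### The theorem. -/

theorem theorem1p2 {V : Type*} [Fintype V] [DecidableEq V]
    (G : SimpleGraph V) [DecidableRel G.Adj]
    (hconn : G.Connected) (hcubic : G.IsRegularOfDegree 3)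
    (hn : 6 ≤ Fintype.card V) (hfactor : G.HasTriangleFactor) :
    (Fintype.card V = 6 → G.IsDominatorWin) ∧
      (6 < Fintype.card V → G.IsStallerWin) := by
  obtain ⟨P, hP⟩ := hfactor
  obtain ⟨m, hm, hcm, hadj⟩ := SimpleGraph.exists_outer_neighbor hcubic hP
  have hU : ∀ v, P.part v ∈ P.parts := fun v => P.part_mem.2 (Finset.mem_univ v)
  have hU3 : ∀ t ∈ P.parts, (Finset.univ.filter fun v => P.part v = t).card = 3 := by
    intro t ht
    rw [← (hP t ht).card_eq]
    congr 1
    ext v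
    simp [P.part_eq_iff_mem ht]
  have hcard : P.parts.card * 3 = Fintype.card V := by
    rw [← Finset.card_univ, ← P.sum_card_parts]
    exact (Finset.sum_const_nat fun t ht => (hP t ht).card_eq).symm
  -- The handshake identity makes the number of triangles even, so more than two means at least
  -- four.
  have heven : Fintype.card V * 3 = 2 * G.edgeFinset.card := by
    rw [← G.sum_degrees_eq_twice_card_edges, ← Finset.card_univ]
    exact (Finset.sum_const_nat fun v _ => hcubic v).symm
  have : Nonempty V := hconn.nonempty
  refine ⟨fun h6 => ?_, fun h6 => ?_⟩
  · obtain ⟨f, hf, hne, hF⟩ :=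
      exists_pairing_of_card_eq_two hm hcm hadj P.parts hU hU3 (by omega)
    exact ⟨MakerBreaker.breakerWinsFirst_of_pairing hf hne hF,
      MakerBreaker.breakerWinsSecond_of_pairing hf hne hF⟩
  · have hwin := makerWinsFrom_of_four_le hconn hm hcm hadj P.parts hU hU3 (by omega)
    exact ⟨MakerBreaker.makerWinsFirst_of_makerWinsFrom hwin,
      MakerBreaker.makerWinsSecond_of_makerWinsFrom hwin⟩
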